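/- **Conventions.** Algebras have nonempty universes; languages of algebras contain function symbols (of arity $\ge 0$) only. A *quasivariety* is a class of similar algebras closed under isomorphic copies, subalgebras, direct products (also of the empty family) and ultraproducts; it is viewed as a category whose arrows are all homomorphisms. Let $\mathscr L_K$ be the language of a quasivariety $K$. A quasivariety $M$ is an *expansion* of $K$ when $\mathscr L_K\subseteq\mathscr L_M$ and $A{\upharpoonright}_{\mathscr L_K}\in K$ for all $A\in M$; then there is a forgetful functor $U\colon M\to K$, whose left adjoint is the free extension functor $F\colon K\to M$, $F(A)=T_M(A)/\theta_A$, where $T_M(A)$ is the free algebra of $M$ over the set $A$ and $\theta_A$ is the least congruence $\theta$ of $T_M(A)$ with $T_M(A)/\theta\in M$ that contains all pairs $\langle t(a_1,\dots,a_n),s(a_1,\dots,a_n)\rangle$ of $\mathscr L_K$-terms with $t^A(\vec a)=s^A(\vec a)$. A *pp formula* is a formula $\exists z_1,\dots,z_m\,\varphi$ with $\varphi$ a finite conjunction of equations. For $n\ge1$, an $n$-ary *pp definable implicit operation* of $K$ is a family $f=\langle f^A: A\in K\rangle$ of partial $n$-ary functions $f^A$ on $A$ that is preserved by homomorphisms (if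 $h\colon A\to B$ and $\vec a\in\mathrm{dom}(f^A)$, then $h(\vec a)\in\mathrm{dom}(f^B)$ and $h(f^A(\vec a))=f^B(h(\vec a))$) and whose graphs are defined in all $A\in K$ by one pp formula $\varphi(x_1,\dots,x_n,y)$ of $\mathscr L_K$. It is *extendable* when for all $A\in K$ and all $\vec a\in A^n$ there is $B\in K$ extending $A$ with $\vec a\in\mathrm{dom}(f^B)$. The extendable pp definable implicit operations form $\mathrm{ext}_{pp}(K)$. Given a family $\mathcal F$ (possibly with repetitions) of members of $\mathrm{ext}_{pp}(K)$, let $\mathscr L_{\mathcal F}$ be $\mathscr L_K$ together with a new $n$-ary symbol $g_f$ for each $n$-ary member $f$ of the family, and let $K[\mathscr L_{\mathcal F}]$ be the class of all $\mathscr L_{\mathcal F}$-algebras $A$ whose $\mathscr L_K$-reduct $A'$ lies in $K$ and in which, for all $f$ in $\mathcal F$, $f^{A'}$ is total and interprets $g_f$. A *pp expansion* of $K$ is a quasivariety that is of the form $\mathbb S(K[\mathscr L_{\mathcal F}])$, where $\mathbb S$ is closure under subalgebras; it is *simple* when it is also of the form $K[\mathscr L_{\mathcal F'}]$ for a family $\mathcal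 F'$ from $\mathrm{ext}_{pp}(K)$. A *Beth companion* of $K$ is a pp expansion of $K$ in which every monomorphism is regular; it is *simple* when it is a simple pp expansion. A full subcategory is *mono-reflective* when its inclusion functor has a left adjoint and the unit of the adjunction is componentwise a monomorphism. **Statement.** Let $M$ be an expansion of a quasivariety $K$ such that every constant symbol (symbol of arity $0$) of $\mathscr L_M$ belongs to $\mathscr L_K$. Then $M$ is a simple Beth companion of $K$ if and only if monomorphisms are regular in $M$ and any one (equivalently, each) of the following conditions holds: 1. $M$ is a simple pp expansion of $K$; 2. the unit of the adjunction $F\dashv U$ is componentwise a monomorphism and the counit is a natural isomorphism; 3. the forgetful functor $U\colon M\to U[M]$ is an isomorphism of categories from $M$ onto its direct image $U[M]$, which is a (full) mono-reflective subcategory of $K$. Moreover, if $M$ is a simple Beth companion of $K$ and $N$ is any expansion of $K$ that adds no constant symbols, in which monomorphisms are regular and whose forgetful functor to $K$ satisfies condition 3, then $M$ and $N$ are faithfully term equivalent relative to $K$: there are arity-preserving maps $\tau$ from $\mathscr L_M$ to the terms of $N$ and $\rho$ from $\mathscr L_N$ to the terms of $M$ (an $n$-ary symbol being sent to a term in $x_1,\dots,x_n$),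 both sending each $n$-ary $f\in\mathscr L_K$ to $f(x_1,\dots,x_n)$, such that for all $A\in M$ and $B\in N$ one has $\rho(A)\in N$, $\tau(B)\in M$, $\tau\rho(A)=A$ and $\rho\tau(B)=B$, where $\rho(A)$ is the algebra on the universe of $A$ in which each symbol $f$ of $\mathscr L_N$ is interpreted as $\rho(f)^A$, and likewise for $\tau(B)$. -/

import Mathlib

universe u

open FirstOrder FirstOrder.Language CategoryTheory

noncomputable section

namespace QV

/-! ### Algebras and quasivarieties

A language of algebras is a first-order language without relation symbols (`IsAlgebraic`).
Universes of algebras are nonempty, and languages and algebras are small relative to `Type u`. -/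

/-- Algebras in the language `L`. -/
structure Alg (L : FirstOrder.Language.{u, 0}) where
  carrier : Type u
  [str : L.Structure carrier]
  [nonempty : Nonempty carrier]

attribute [instance] Alg.str Alg.nonempty

instance (L : FirstOrder.Language.{u, 0}) : CoeSort (Alg L) (Type u) := ⟨Alg.carrier⟩

variable {L L₁ L₂ : FirstOrder.Language.{u, 0}}

/-- A nonempty subalgebra, viewed as an algebra. -/
def Alg.sub (A : Alg L) (S : L.Substructure A) (hS : Nonempty S) : Alg L where
  carrier := S

/-- The direct product of a family of algebras, with the componentwise operations. The index type
may be empty, in which case the product is the one-element algebra. -/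
def Alg.pi {I : Type u} (A : I → Alg L) : Alg L where
  carrier := ∀ i, A i
  str :=
    { funMap := fun f x i => Structure.funMap f (fun k => x k i)
      RelMap := fun r x => ∀ i, Structure.RelMap r (fun k => x k i) }

/-- The ultraproduct of a family of algebras. -/
def Alg.ultraproduct {I : Type u} (U : Ultrafilter I) (A : I → Alg L) : Alg L where
  carrier := (U : Filter I).Product (fun i => (A i : Type u))
  nonempty := ⟨Quotient.mk _ (fun _ => Classical.arbitrary _)⟩

/-- A quasivariety: a class of similar algebras closed under isomorphic copies, subalgebras,
direct products and ultraproducts. -/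
structure Quasivariety (L : FirstOrder.Language.{u, 0}) where
  Mem : Alg L → Prop
  iso_mem : ∀ A B : Alg L, (A ≃[L] B) → Mem A → Mem B
  sub_mem : ∀ (A : Alg L) (S : L.Substructure A) (hS : Nonempty S), Mem A → Mem (A.sub S hS)
  pi_mem : ∀ {I : Type u} (A : I → Alg L), (∀ i, Mem (A i)) → Mem (Alg.pi A)
  ultraproduct_mem : ∀ {I : Type u} (U : Ultrafilter I) (A : I → Alg L),
    (∀ i, Mem (A i)) → Mem (Alg.ultraproduct U A)

theorem Quasivariety.mem_of_embedding (K : Quasivariety L) {A B : Alg L} (e : A ↪[L] B)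
    (hB : K.Mem B) : K.Mem A := by
  have hne : Nonempty e.toHom.range := ⟨e.equivRange (Classical.arbitrary _)⟩
  exact K.iso_mem (B.sub e.toHom.range hne) A e.equivRange.symm (K.sub_mem B _ hne hB)

/-- The members of a quasivariety. -/
structure Quasivariety.Obj (K : Quasivariety L) where
  alg : Alg L
  mem : K.Mem alg

/-- A quasivariety as a category: the arrows are the homomorphisms. -/
instance (K : Quasivariety L) : Category.{u} K.Obj where
  Hom A B := A.alg →[L] B.alg
  id A := Hom.id L A.alg
  comp f g := Hom.comp g f

/-- An arrow of `K`, as a homomorphism. -/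
abbrev Quasivariety.toHom {K : Quasivariety L} {A B : K.Obj} (h : A ⟶ B) : A.alg →[L] B.alg := h

/-! ### Expansions and the forgetful functor

An inclusion of languages `L ⊆ L₁` is presented by an injective language map `ι : L →ᴸ L₁`. -/

/-- The reduct of an `L₁`-algebra to `L`. -/
def Alg.reduct (ι : L →ᴸ L₁) (A : Alg L₁) : Alg L where
  carrier := A
  str := ι.reduct A

/-- `M` is an expansion of `K`: the language of `K` is contained (via `ι`) in that of `M`, and the
reducts of members of `M` belong to `K`. -/
structure IsExpansion (ι : L →ᴸ L₁) (K : Quasivariety L) (M : Quasivariety L₁) : Prop where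
  injective : ι.Injective
  reduct_mem : ∀ A : Alg L₁, M.Mem A → K.Mem (A.reduct ι)

/-- A homomorphism of `L₁`-algebras is a homomorphism of the `L`-reducts. -/
def Alg.reductHom (ι : L →ᴸ L₁) {A B : Alg L₁} (h : A →[L₁] B) :
    A.reduct ι →[L] B.reduct ι where
  toFun := h
  map_fun' f x := h.map_fun (ι.onFunction f) x
  map_rel' r x hx := h.map_rel (ι.onRelation r) x hx

/-- The forgetful functor `U : M ⥤ K`. -/
def forgetful {ι : L →ᴸ L₁} {K : Quasivariety L} {M : Quasivariety L₁} (h : IsExpansion ι K M) :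
    M.Obj ⥤ K.Obj where
  obj A := ⟨A.alg.reduct ι, h.reduct_mem A.alg A.mem⟩
  map f := Alg.reductHom ι f

/-! ### Congruences, free algebras and the free extension functor -/

/-- Congruences of an algebra. -/
structure Congruence (A : Alg L) extends Setoid A where
  compat : ∀ {n : ℕ} (f : L.Functions n) (x y : Fin n → A), (∀ i, r (x i) (y i)) →
    r (Structure.funMap f x) (Structure.funMap f y)

theorem realize_reduct (ι : L →ᴸ L₁) {X : Type u} (B : Alg L₁) (v : X → B) (t : L.Term X) :
    (ι.onTerm t).realize v = Term.realize (M := B.reduct ι) v t := by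
  induction t with
  | var => rfl
  | func f ts ih =>
    change Structure.funMap (ι.onFunction f) (fun i => (ι.onTerm (ts i)).realize v) = _
    simp only [ih]
    rfl

theorem hom_realize {A B : Alg L} (h : A →[L] B) (t : L.Term A) :
    Term.realize (h : A → B) t = h (t.realize id) := by
  induction t with
  | var => rfl
  | func f ts ih =>
    simp only [Term.realize, ih]
    exact (h.map_fun f _).symm

section AlgebraicLanguage

variable [L.IsAlgebraic]

/-- The operations of `A` are compatible with a congruence. -/
abbrev Congruence.prestructure {A : Alg L} (θ : Congruence A) : L.Prestructure θ.toSetoid where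
  toStructure := A.str
  fun_equiv := fun x y h => θ.compat _ x y h
  rel_equiv := fun {_ r} _ _ _ => isEmptyElim r

/-- The quotient of an algebra by a congruence. -/
def Alg.quot (A : Alg L) (θ : Congruence A) : Alg L where
  carrier := Quotient θ.toSetoid
  str := @FirstOrder.Language.quotientStructure L A θ.toSetoid θ.prestructure
  nonempty := ⟨Quotient.mk θ.toSetoid (Classical.arbitrary A)⟩

/-- The canonical projection onto a quotient. -/
def Alg.proj (A : Alg L) (θ : Congruence A) : A →[L] A.quot θ where
  toFun a := (Quotient.mk θ.toSetoid a : Quotient θ.toSetoid)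
  map_fun' f x := (@FirstOrder.Language.funMap_quotient_mk' L A θ.toSetoid θ.prestructure _ f x).symm
  map_rel' r := isEmptyElim r

theorem Alg.proj_surjective (A : Alg L) (θ : Congruence A) : Function.Surjective (A.proj θ) :=
  fun q => Quotient.inductionOn q fun a => ⟨a, rfl⟩

theorem Alg.proj_eq_iff (A : Alg L) (θ : Congruence A) (a b : A) :
    A.proj θ a = A.proj θ b ↔ θ.r a b :=
  ⟨fun h => Quotient.exact h, fun h => Quotient.sound h⟩

/-- The least `M`-congruence of `A` containing `X`, as the intersection of all congruences `θ` that
contain `X` and have `A / θ ∈ M`; that it is itself an `M`-congruence is `quot_cg_mem`. -/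
def Quasivariety.cg (M : Quasivariety L) (A : Alg L) (X : Set (A × A)) : Congruence A where
  r a b := ∀ θ : Congruence A, M.Mem (A.quot θ) → (∀ p ∈ X, θ.r p.1 p.2) → θ.r a b
  iseqv :=
    { refl := fun a θ _ _ => θ.iseqv.refl a
      symm := fun h θ h1 h2 => θ.iseqv.symm (h θ h1 h2)
      trans := fun h h' θ h1 h2 => θ.iseqv.trans (h θ h1 h2) (h' θ h1 h2) }
  compat f x y h θ h1 h2 := θ.compat f x y fun i => h i θ h1 h2

theorem Quasivariety.cg_of_mem (M : Quasivariety L) (A : Alg L) (X : Set (A × A)) {a b : A}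
    (h : (a, b) ∈ X) : (M.cg A X).r a b :=
  fun _ _ hX => hX _ h

/-- The homomorphism induced on a quotient. -/
def Alg.lift {A B : Alg L} (θ : Congruence A) (h : A →[L] B) (hθ : ∀ a b, θ.r a b → h a = h b) :
    A.quot θ →[L] B where
  toFun q := Quotient.lift (s := θ.toSetoid) h hθ q
  map_fun' {n} f x := by
    choose y hy using fun i => A.proj_surjective θ (x i)
    obtain rfl : (fun i => A.proj θ (y i)) = x := funext hy
    have h1 := (A.proj θ).map_fun f y
    have h2 := h.map_fun f y
    change Quotient.lift (s := θ.toSetoid) h hθ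
      (Structure.funMap f (A.proj θ ∘ y) : A.quot θ) = _
    rw [← h1]
    exact h2
  map_rel' r := isEmptyElim r

theorem Alg.lift_proj {A B : Alg L} (θ : Congruence A) (h : A →[L] B)
    (hθ : ∀ a b, θ.r a b → h a = h b) (a : A) : Alg.lift θ h hθ (A.proj θ a) = h a := rfl

theorem Quasivariety.quot_cg_mem (M : Quasivariety L) (A : Alg L) (X : Set (A × A)) :
    M.Mem (A.quot (M.cg A X)) := by
  let I : Type u := {θ : Congruence A // M.Mem (A.quot θ) ∧ ∀ p ∈ X, θ.r p.1 p.2}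
  let B : I → Alg L := fun θ => A.quot θ.1
  let g : A →[L] Alg.pi B :=
    { toFun := fun a θ => A.proj θ.1 a
      map_fun' := fun f x => funext fun θ => (A.proj θ.1).map_fun f x
      map_rel' := fun r => isEmptyElim r }
  have key : ∀ a b, (M.cg A X).r a b ↔ g a = g b := by
    intro a b
    constructor
    · intro h
      exact funext fun θ => (A.proj_eq_iff θ.1 a b).2 (h θ.1 θ.2.1 θ.2.2)
    · intro h θ h1 h2
      exact (A.proj_eq_iff θ a b).1 (congrFun h (⟨θ, h1, h2⟩ : I))
  let l := Alg.lift (M.cg A X) g (fun a b h => (key a b).1 h)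
  have hl : Function.Injective l := by
    intro p q hpq
    obtain ⟨a, rfl⟩ := A.proj_surjective _ p
    obtain ⟨b, rfl⟩ := A.proj_surjective _ q
    exact (A.proj_eq_iff _ a b).2 ((key a b).2 hpq)
  exact M.mem_of_embedding (Embedding.ofInjective hl) (M.pi_mem B fun θ => θ.2.1)

/-- A homomorphism to a member of `M` that identifies all pairs in `X` identifies all pairs in the
`M`-congruence generated by `X`. -/
theorem Quasivariety.eq_of_cg (M : Quasivariety L) {A B : Alg L} (X : Set (A × A))
    (hB : M.Mem B) (h : A →[L] B) (hX : ∀ p ∈ X, h p.1 = h p.2) {a b : A}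
    (hab : (M.cg A X).r a b) : h a = h b := by
  let θ : Congruence A :=
    { r := fun a b => h a = h b
      iseqv := ⟨fun _ => rfl, fun e => e.symm, fun e e' => e.trans e'⟩
      compat := fun f x y e => by
        rw [h.map_fun, h.map_fun]
        exact congrArg _ (funext e) }
  let l := Alg.lift θ h (fun _ _ e => e)
  have hl : Function.Injective l := by
    intro p q hpq
    obtain ⟨a, rfl⟩ := A.proj_surjective _ p
    obtain ⟨b, rfl⟩ := A.proj_surjective _ q
    exact (A.proj_eq_iff _ a b).2 hpq
  exact hab θ (M.mem_of_embedding (Embedding.ofInjective hl) hB) hX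

/-- The algebra of terms with variables in a nonempty set `X`. -/
def termAlg (L : FirstOrder.Language.{u, 0}) (X : Type u) [Nonempty X] : Alg L where
  carrier := L.Term X
  str :=
    { funMap := fun f ts => Term.func f ts
      RelMap := fun _ _ => False }
  nonempty := ⟨Term.var (Classical.arbitrary X)⟩

/-- Evaluation of terms, as a homomorphism. -/
def evalHom {X : Type u} [Nonempty X] (B : Alg L) (v : X → B) : termAlg L X →[L] B where
  toFun t := Term.realize v t
  map_fun' _ _ := rfl
  map_rel' r := isEmptyElim r

/-- The free algebra `T_M(X)`: terms modulo the least `M`-congruence, that is, modulo the equations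
valid in `M`. -/
def Quasivariety.free (M : Quasivariety L) (X : Type u) [Nonempty X] : Alg L :=
  (termAlg L X).quot (M.cg (termAlg L X) ∅)

/-- The class in `T_M(X)` of a term. -/
def Quasivariety.freeMk (M : Quasivariety L) {X : Type u} [Nonempty X] (t : L.Term X) : M.free X :=
  (termAlg L X).proj (M.cg (termAlg L X) ∅) t

end AlgebraicLanguage

section FreeExtension

variable [L₁.IsAlgebraic]

/-- The positive diagram `diag⁺(A)` of an `L`-algebra `A`, viewed in `T_M(A)`: the pairs
`⟨t(a₁, …, aₙ), s(a₁, …, aₙ)⟩` of `L`-terms with `t^A(a₁, …, aₙ) = s^A(a₁, …, aₙ)`. -/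
def posDiag (ι : L →ᴸ L₁) (M : Quasivariety L₁) (A : Alg L) : Set (M.free A × M.free A) :=
  {p | ∃ t s : L.Term A, t.realize id = s.realize id ∧
    p = (M.freeMk (ι.onTerm t), M.freeMk (ι.onTerm s))}

/-- The free extension `F(A) = T_M(A) / θ_A`, where `θ_A` is the `M`-congruence of `T_M(A)`
generated by `diag⁺(A)`. -/
def freeExt (ι : L →ᴸ L₁) (M : Quasivariety L₁) (A : Alg L) : M.Obj where
  alg := (M.free A).quot (M.cg (M.free A) (posDiag ι M A))
  mem := M.quot_cg_mem _ _

/-- The element `t / θ_A` of `F(A)` given by a term `t` of `M` with variables in `A`. -/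
def freeExtMk (ι : L →ᴸ L₁) (M : Quasivariety L₁) (A : Alg L) (t : L₁.Term A) :
    (freeExt ι M A).alg :=
  (M.free A).proj (M.cg (M.free A) (posDiag ι M A)) (M.freeMk t)

theorem freeExtMk_func (ι : L →ᴸ L₁) (M : Quasivariety L₁) (A : Alg L) {n : ℕ}
    (f : L₁.Functions n) (ts : Fin n → L₁.Term A) :
    freeExtMk ι M A (Term.func f ts) =
      Structure.funMap f (fun i => freeExtMk ι M A (ts i)) := by
  have h1 := ((termAlg L₁ A).proj (M.cg (termAlg L₁ A) ∅)).map_fun f ts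
  have h2 := ((M.free A).proj (M.cg (M.free A) (posDiag ι M A))).map_fun f
    (fun i => M.freeMk (ts i))
  exact (congrArg ((M.free A).proj (M.cg (M.free A) (posDiag ι M A))) h1).trans h2

theorem freeExtMk_surjective (ι : L →ᴸ L₁) (M : Quasivariety L₁) (A : Alg L) :
    Function.Surjective (freeExtMk ι M A) := by
  intro q
  obtain ⟨p, rfl⟩ := (M.free A).proj_surjective _ q
  obtain ⟨t, rfl⟩ := (termAlg L₁ A).proj_surjective _ p
  exact ⟨t, rfl⟩

theorem freeExtMk_diag (ι : L →ᴸ L₁) (M : Quasivariety L₁) (A : Alg L) (t s : L.Term A)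
    (h : t.realize id = s.realize id) :
    freeExtMk ι M A (ι.onTerm t) = freeExtMk ι M A (ι.onTerm s) :=
  ((M.free A).proj_eq_iff _ _ _).2 (M.cg_of_mem _ _ ⟨t, s, h, rfl⟩)

/-- The homomorphism `F(A) → B` that extends a homomorphism `A → U(B)`. -/
def freeExtLift {ι : L →ᴸ L₁} {M : Quasivariety L₁} {A : Alg L} (B : M.Obj)
    (h : A →[L] B.alg.reduct ι) : (freeExt ι M A).alg →[L₁] B.alg :=
  Alg.lift _
    (Alg.lift (A := termAlg L₁ A) (M.cg (termAlg L₁ A) ∅) (evalHom B.alg h)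
      (fun _ _ hab => M.eq_of_cg ∅ B.mem _ (by simp) hab))
    (fun _ _ hab => M.eq_of_cg (posDiag ι M A) B.mem _ (by
      rintro _ ⟨t, s, hts, rfl⟩
      change Term.realize (M := B.alg) h (ι.onTerm t) = Term.realize (M := B.alg) h (ι.onTerm s)
      exact (realize_reduct ι B.alg h t).trans ((hom_realize h t).trans ((congrArg h hts).trans
        ((hom_realize h s).symm.trans (realize_reduct ι B.alg h s).symm)))) hab)

theorem freeExtLift_mk {ι : L →ᴸ L₁} {M : Quasivariety L₁} {A : Alg L} (B : M.Obj)
    (h : A →[L] B.alg.reduct ι) (t : L₁.Term A) :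
    freeExtLift B h (freeExtMk ι M A t) = Term.realize (M := B.alg) h t := rfl

theorem freeExt_hom_mk {ι : L →ᴸ L₁} {M : Quasivariety L₁} {A : Alg L} {B : Alg L₁}
    (g : (freeExt ι M A).alg →[L₁] B) (t : L₁.Term A) :
    g (freeExtMk ι M A t) = t.realize (fun a => g (freeExtMk ι M A (Term.var a))) := by
  induction t with
  | var => rfl
  | func f ts ih =>
    rw [freeExtMk_func]
    refine (g.map_fun f _).trans ?_
    exact congrArg _ (funext ih)

variable [L.IsAlgebraic]

/-- The map `a ↦ a / θ_A`, as a homomorphism from `A` to `U(F(A))`. -/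
def freeExtUnit (ι : L →ᴸ L₁) (M : Quasivariety L₁) (A : Alg L) :
    A →[L] (freeExt ι M A).alg.reduct ι where
  toFun a := freeExtMk ι M A (Term.var a)
  map_fun' f x :=
    (freeExtMk_diag ι M A (Term.var (Structure.funMap f x))
      (Term.func f fun i => Term.var (x i)) rfl).trans (freeExtMk_func ι M A _ _)
  map_rel' r := isEmptyElim r

/-- The natural bijection between homomorphisms `F(A) → B` and homomorphisms `A → U(B)`, given by
restriction along `a ↦ a / θ_A`. -/
def freeExtEquiv {ι : L →ᴸ L₁} {K : Quasivariety L} {M : Quasivariety L₁}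
    (h : IsExpansion ι K M) (A : K.Obj) (B : M.Obj) :
    (freeExt ι M A.alg ⟶ B) ≃ (A ⟶ (forgetful h).obj B) where
  toFun g := Hom.comp (Alg.reductHom ι (Quasivariety.toHom g)) (freeExtUnit ι M A.alg)
  invFun g := freeExtLift B (Quasivariety.toHom g)
  left_inv g := by
    refine Hom.ext fun q => ?_
    obtain ⟨t, rfl⟩ := freeExtMk_surjective ι M A.alg q
    exact (freeExt_hom_mk (Quasivariety.toHom g) t).symm
  right_inv g := Hom.ext fun a => rfl

/-- The free extension functor `F : K ⥤ M`. -/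
def freeExtFunctor {ι : L →ᴸ L₁} {K : Quasivariety L} {M : Quasivariety L₁}
    (h : IsExpansion ι K M) : K.Obj ⥤ M.Obj :=
  Adjunction.leftAdjointOfEquiv (G := forgetful h) (F_obj := fun A => freeExt ι M A.alg)
    (freeExtEquiv h) (fun _ _ _ _ _ => rfl)

/-- The adjunction `F ⊣ U`. -/
def freeExtAdj {ι : L →ᴸ L₁} {K : Quasivariety L} {M : Quasivariety L₁}
    (h : IsExpansion ι K M) : freeExtFunctor h ⊣ forgetful h :=
  Adjunction.adjunctionOfEquivLeft (freeExtEquiv h) (fun _ _ _ _ _ => rfl)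

theorem freeExtAdj_unit_apply {ι : L →ᴸ L₁} {K : Quasivariety L} {M : Quasivariety L₁}
    (h : IsExpansion ι K M) (A : K.Obj) (a : A.alg) :
    Quasivariety.toHom ((freeExtAdj h).unit.app A) a = freeExtMk ι M A.alg (Term.var a) := rfl

theorem freeExtAdj_counit_apply {ι : L →ᴸ L₁} {K : Quasivariety L} {M : Quasivariety L₁}
    (h : IsExpansion ι K M) (B : M.Obj) (t : L₁.Term B.alg) :
    Quasivariety.toHom ((freeExtAdj h).counit.app B)
      (freeExtMk ι M (B.alg.reduct ι) t) = t.realize id := rfl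

end FreeExtension

/-- The second condition: the unit of `F ⊣ U` is componentwise a monomorphism and the counit is a
natural isomorphism. -/
def UnitMonoCounitIso [L.IsAlgebraic] [L₁.IsAlgebraic] {ι : L →ᴸ L₁} {K : Quasivariety L}
    {M : Quasivariety L₁} (h : IsExpansion ι K M) : Prop :=
  (∀ A : K.Obj, Mono ((freeExtAdj h).unit.app A)) ∧ IsIso (freeExtAdj h).counit

/-! ### Mono-reflective subcategories -/

section Categories

universe v₁ v₂ w₁ w₂

variable {C : Type w₁} [Category.{v₁} C] {D : Type w₂} [Category.{v₂} D]

/-- The full subcategory of `D` on `P` is mono-reflective: the inclusion has a left adjoint, and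
the unit is componentwise a monomorphism. -/
def IsMonoReflective (P : ObjectProperty D) : Prop :=
  ∃ (R : D ⥤ P.FullSubcategory) (adj : R ⊣ P.ι), ∀ X : D, Mono (adj.unit.app X)

/-- Isomorphisms of categories: functors with a strict inverse. -/
def IsCatIso (F : C ⥤ D) : Prop :=
  ∃ G : D ⥤ C, F ⋙ G = 𝟭 C ∧ G ⋙ F = 𝟭 D

/-- The objects of the direct image of a functor. -/
def imageObj (F : C ⥤ D) : ObjectProperty D := fun Y => ∃ X : C, F.obj X = Y

/-- The functor `F` is an isomorphism from its domain onto its direct image, and the latter is a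
mono-reflective (in particular, full) subcategory of the codomain. The direct image consists of the
objects `F X` and the arrows `F f`. -/
structure IsIsoOntoMonoReflective (F : C ⥤ D) : Prop where
  image_full : ∀ {X Y : D}, imageObj F X → imageObj F Y → ∀ f : X ⟶ Y,
    (⊤ : MorphismProperty C).strictMap F f
  iso : IsCatIso ((imageObj F).lift F fun X => ⟨X, rfl⟩)
  monoReflective : IsMonoReflective (imageObj F)

end Categories

/-! ### Implicit operations and pp expansions -/

/-- An `n`-ary operation of `K`: a family of partial `n`-ary functions on the members of `K` that is
globally preserved by homomorphisms. Here `b ∈ f.fn A a` means that `a` is in the domain of `f^A`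
and `f^A a = b`. -/
structure Operation (K : Quasivariety L) (n : ℕ) where
  fn : ∀ A : K.Obj, (Fin n → A.alg) →. A.alg
  preserved : ∀ {A B : K.Obj} (h : A ⟶ B) (a : Fin n → A.alg) (b : A.alg),
    b ∈ fn A a → Quasivariety.toHom h b ∈ fn B (Quasivariety.toHom h ∘ a)

/-- Primitive positive formulas: `∃ z₁ … zₘ` followed by a finite conjunction of equations. -/
def IsPP {α : Type} (φ : L.Formula α) : Prop :=
  ∃ (m k : ℕ) (t s : Fin k → L.Term (α ⊕ Fin m)),
    φ = Formula.iExs (Fin m) (Formula.iInf fun i => (t i).equal (s i))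

namespace Operation

variable {K : Quasivariety L} {n : ℕ}

/-- The formula `φ(x₁, …, xₙ, y)` defines `f`. -/
def DefinedBy (f : Operation K n) (φ : L.Formula (Fin (n + 1))) : Prop :=
  ∀ (A : K.Obj) (a : Fin n → A.alg) (b : A.alg),
    φ.Realize (Fin.snoc a b : Fin (n + 1) → A.alg) ↔ b ∈ f.fn A a

/-- Implicit operations: operations of positive arity definable by a first-order formula. -/
def IsImplicit (f : Operation K n) : Prop :=
  1 ≤ n ∧ ∃ φ : L.Formula (Fin (n + 1)), f.DefinedBy φ

/-- Definability by a pp formula. -/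
def IsPPDefinable (f : Operation K n) : Prop :=
  ∃ φ : L.Formula (Fin (n + 1)), IsPP φ ∧ f.DefinedBy φ

/-- Extendability: for every `A ∈ K` and every tuple of elements of `A` there is a member of `K`
extending `A` in which the operation is defined on that tuple. -/
def IsExtendable (f : Operation K n) : Prop :=
  ∀ (A : K.Obj) (a : Fin n → A.alg), ∃ (B : K.Obj) (e : A.alg ↪[L] B.alg), (f.fn B (e ∘ a)).Dom

/-- Membership in `ext_pp(K)`: extendable pp definable implicit operations. -/
def MemExtPP (f : Operation K n) : Prop :=
  f.IsImplicit ∧ f.IsPPDefinable ∧ f.IsExtendable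

end Operation

/-- A family of operations of `K` indexed by the symbols of `L₁` that are not in `L` (with matching
arities). The language `L₁` then is the language obtained by adding to `L` a new symbol for each
member of the family. -/
abbrev OpFamily (ι : L →ᴸ L₁) (K : Quasivariety L) : Type (u + 1) :=
  ∀ (n : ℕ) (g : L₁.Functions n), g ∉ Set.range (fun f : L.Functions n => ι.onFunction f) →
    Operation K n

/-- All members of the family belong to `ext_pp(K)`. -/
def OpFamily.InExtPP {ι : L →ᴸ L₁} {K : Quasivariety L} (F : OpFamily ι K) : Prop :=
  ∀ n g hg, (F n g hg).MemExtPP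

/-- Membership in the class obtained by adding the family `F` to `K`: the `L₁`-algebras whose
`L`-reduct is a member of `K` on which all members of `F` are total, and in which every new symbol
is interpreted as the corresponding member of `F`. -/
def OpFamily.Adjoined {ι : L →ᴸ L₁} {K : Quasivariety L} (F : OpFamily ι K) (A : Alg L₁) : Prop :=
  ∃ hA : K.Mem (A.reduct ι), ∀ n g hg (a : Fin n → A),
    (Structure.funMap g a : A) ∈ (F n g hg).fn ⟨A.reduct ι, hA⟩ a

/-- `M` is a pp expansion of `K`: the closure under subalgebras of the class obtained by adding to
`K` a family from `ext_pp(K)`. -/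
def IsPPExpansion (ι : L →ᴸ L₁) (K : Quasivariety L) (M : Quasivariety L₁) : Prop :=
  ∃ F : OpFamily ι K, F.InExtPP ∧
    ∀ A : Alg L₁, M.Mem A ↔ ∃ B : Alg L₁, F.Adjoined B ∧ Nonempty (A ↪[L₁] B)

/-- `M` is a simple pp expansion of `K`: a pp expansion that is itself the class obtained by adding
to `K` a family from `ext_pp(K)`. -/
def IsSimplePPExpansion (ι : L →ᴸ L₁) (K : Quasivariety L) (M : Quasivariety L₁) : Prop :=
  IsPPExpansion ι K M ∧
    ∃ F : OpFamily ι K, F.InExtPP ∧ ∀ A : Alg L₁, M.Mem A ↔ F.Adjoined A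

/-- Beth companions: pp expansions in which monomorphisms are regular. -/
def IsBethCompanion (ι : L →ᴸ L₁) (K : Quasivariety L) (M : Quasivariety L₁) : Prop :=
  IsPPExpansion ι K M ∧ IsRegularMonoCategory M.Obj

/-- Simple Beth companions. -/
def IsSimpleBethCompanion (ι : L →ᴸ L₁) (K : Quasivariety L) (M : Quasivariety L₁) : Prop :=
  IsBethCompanion ι K M ∧ IsSimplePPExpansion ι K M

/-- Every constant symbol of `L₁` already belongs to `L`. -/
def NoNewConstants (ι : L →ᴸ L₁) : Prop :=
  ∀ c : L₁.Functions 0, c ∈ Set.range (fun f : L.Functions 0 => ι.onFunction f)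

/-! ### Faithful term equivalence -/

/-- An arity-preserving assignment of `L₂`-terms to the symbols of `L₁`. -/
abbrev Translation (L₁ L₂ : FirstOrder.Language.{u, 0}) : Type u :=
  ∀ n : ℕ, L₁.Functions n → L₂.Term (Fin n)

/-- The `L₁`-algebra `τ(B)` on the universe of an `L₂`-algebra `B`. -/
def Translation.app (τ : Translation L₁ L₂) (B : Alg L₂) : Alg L₁ where
  carrier := B
  str :=
    { funMap := fun {n} f a => (τ n f).realize a
      RelMap := fun _ _ => False }

/-- The translation sends each basic symbol of `L` to itself, applied to distinct variables. -/
def Translation.Fixes (τ : Translation L₁ L₂) (ι₁ : L →ᴸ L₁) (ι₂ : L →ᴸ L₂) : Prop :=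
  ∀ (n : ℕ) (f : L.Functions n),
    τ n (ι₁.onFunction f) = Term.func (ι₂.onFunction f) fun i => Term.var i

/-- `M₁` and `M₂` are faithfully term equivalent relative to the language `L` of `K`. -/
def FaithfullyTermEquivalent (ι₁ : L →ᴸ L₁) (ι₂ : L →ᴸ L₂)
    (M₁ : Quasivariety L₁) (M₂ : Quasivariety L₂) : Prop :=
  ∃ (τ : Translation L₁ L₂) (ρ : Translation L₂ L₁),
    τ.Fixes ι₁ ι₂ ∧ ρ.Fixes ι₂ ι₁ ∧
    (∀ A : Alg L₁, M₁.Mem A → M₂.Mem (ρ.app A) ∧ τ.app (ρ.app A) = A) ∧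
    (∀ B : Alg L₂, M₂.Mem B → M₁.Mem (τ.app B) ∧ ρ.app (τ.app B) = B)

end QV

end

/-!
For an expansion `M` of `K` that adds no constants, each of the three conditions says the same thing
about elements, recorded as `IsReflectiveExpansion`: homomorphisms between `L`-reducts of members of
`M` preserve all operations of `M`, and every member of `K` embeds into the reduct of a member of
`M`. Regularity of monomorphisms plays no role in this equivalence.

* For the categorical conditions this is the usual calculus of adjunctions (a right adjoint is fully
  faithful if and only if the counit is invertible), together with the facts that monomorphisms of a
  quasivariety are injective and that, when the forgetful functor is full, the structure of a member
  of `M` is determined by its reduct: `unitMonoCounitIso_iff`, `isIsoOntoMonoReflective_iff`.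
* If `M` is obtained by adjoining operations in `ext_pp(K)`, homomorphisms preserve them by
  definition. To embed a member of `K` into one on which all of them are total, the operations are
  made defined on finitely many tuples by extendability, on all tuples of a given algebra by an
  ultraproduct and Łoś's theorem, and on all tuples of an extension by the union of an `ω`-chain:
  `exists_total_extension`.
* Conversely, let `g` be an `n`-ary basic operation of `M` with `n ≥ 1`, and let `T` be the free
  algebra of `M` on `x₁, …, xₙ`. A map from `T` to a member of `M` that respects the `L`-diagram of
  `T` is a homomorphism of `L`-reducts, hence preserves `g`. By compactness a finite part of the
  diagram suffices, and this part, with the elements of `T` as existentially quantified variables,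
  is a pp definition of `g` throughout `M`: `exists_pp_definition`. The embeddings into reducts show
  that the formula defines an extendable partial operation on all of `K`, and that the algebras with
  these operations adjoined are exactly the members of `M`.

For uniqueness, let `B` be a member of `N`, embedded into the reduct of a member `C` of `M`, which in
turn is embedded into the reduct of a member `D` of `N`. Since `B` is an equalizer in `N` of
homomorphisms from `D`, which preserve the operations of `M`, it is closed under the operations of
`C`. So `B` carries a structure of a member of `M` with the same `L`-reduct
(`exists_companionStructure`), and likewise with `M` and `N` exchanged. Each operation of `M` is thus
an operation on the members of `N` preserved by all homomorphisms, and as such it is the term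
operation read off from the free algebras of `N` (`exists_term`).
-/

noncomputable section

namespace QV

variable {L L₁ L₂ : FirstOrder.Language.{u, 0}}

/-! ### Homomorphisms, free algebras and monomorphisms -/

section Basic

variable [L.IsAlgebraic]

/-- In an algebraic language, a map that commutes with the operations is a homomorphism. -/
def Alg.homMk {A B : Alg L} (h : A → B)
    (hf : ∀ (n : ℕ) (f : L.Functions n) (x : Fin n → A),
      h (Structure.funMap f x) = Structure.funMap f (h ∘ x)) : A →[L] B where
  toFun := h
  map_fun' f x := hf _ f x
  map_rel' r := isEmptyElim r

theorem Quasivariety.mem_of_injective (K : Quasivariety L) {A B : Alg L} (h : A →[L] B)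
    (hh : Function.Injective h) (hB : K.Mem B) : K.Mem A :=
  K.mem_of_embedding (Embedding.ofInjective hh) hB

theorem Quasivariety.free_mem (M : Quasivariety L) (X : Type u) [Nonempty X] :
    M.Mem (M.free X) :=
  M.quot_cg_mem _ _

/-- The homomorphism from a free algebra that extends an assignment of the generators. -/
def Quasivariety.freeLift (M : Quasivariety L) {X : Type u} [Nonempty X] {B : Alg L}
    (hB : M.Mem B) (v : X → B) : M.free X →[L] B :=
  Alg.lift (A := termAlg L X) _ (evalHom B v)
    (fun _ _ hab => M.eq_of_cg ∅ hB _ (by simp) hab)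

theorem Quasivariety.freeMk_surjective (M : Quasivariety L) {X : Type u} [Nonempty X] :
    Function.Surjective (M.freeMk (X := X)) :=
  (termAlg L X).proj_surjective _

theorem Quasivariety.hom_freeMk (M : Quasivariety L) {X : Type u} [Nonempty X] {B : Alg L}
    (h : M.free X →[L] B) (t : L.Term X) :
    h (M.freeMk t) = t.realize fun x => h (M.freeMk (Term.var x)) := by
  induction t with
  | var => rfl
  | func f ts ih =>
    have h1 := ((termAlg L X).proj (M.cg (termAlg L X) ∅)).map_fun f ts
    refine (congrArg h h1).trans ((h.map_fun f _).trans ?_)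
    exact congrArg _ (funext ih)

theorem Quasivariety.free_hom_ext (M : Quasivariety L) {X : Type u} [Nonempty X] {B : Alg L}
    {h h' : M.free X →[L] B} (e : ∀ x, h (M.freeMk (Term.var x)) = h' (M.freeMk (Term.var x))) :
    h = h' := by
  refine Hom.ext fun q => ?_
  obtain ⟨t, rfl⟩ := M.freeMk_surjective q
  rw [M.hom_freeMk, M.hom_freeMk, funext e]

/-- In a quasivariety, monomorphisms are injective: elements are the same as arrows from the free
algebra on one generator. -/
theorem mono_iff_injective {K : Quasivariety L} {A B : K.Obj} (h : A ⟶ B) :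
    Mono h ↔ Function.Injective (Quasivariety.toHom h) := by
  constructor
  · intro hm a a' haa
    let T : K.Obj := ⟨K.free PUnit, K.free_mem PUnit⟩
    let p : T ⟶ A := K.freeLift A.mem fun _ => a
    let p' : T ⟶ A := K.freeLift A.mem fun _ => a'
    have hp : p ≫ h = p' ≫ h := K.free_hom_ext fun _ => haa
    have := (cancel_mono h).1 hp
    exact congrArg (fun q : T ⟶ A => Quasivariety.toHom q (K.freeMk (Term.var PUnit.unit))) this
  · intro hi
    refine ⟨fun p q hpq => Hom.ext fun x => hi ?_⟩
    exact congrArg (fun r => Quasivariety.toHom r x) hpq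

/-- When monomorphisms are regular, the range of an injective homomorphism is the set of elements on
which two homomorphisms agree. -/
theorem exists_separating {K : Quasivariety L} [IsRegularMonoCategory K.Obj] {A B : K.Obj}
    (h : A ⟶ B) (hi : Function.Injective (Quasivariety.toHom h)) :
    ∃ (C : K.Obj) (p q : B ⟶ C),
      (∀ a, Quasivariety.toHom p (Quasivariety.toHom h a) =
        Quasivariety.toHom q (Quasivariety.toHom h a)) ∧
      ∀ b, Quasivariety.toHom p b = Quasivariety.toHom q b →
        b ∈ Set.range (Quasivariety.toHom h) := by
  have : Mono h := (mono_iff_injective h).2 hi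
  let r := regularMonoOfMono h
  refine ⟨r.Z, r.left, r.right, fun a => ?_, fun b hb => ?_⟩
  · exact congrArg (fun q => Quasivariety.toHom q a) r.w
  · let T : K.Obj := ⟨K.free PUnit, K.free_mem PUnit⟩
    let p : T ⟶ B := K.freeLift B.mem fun _ => b
    have hp : p ≫ r.left = p ≫ r.right := K.free_hom_ext fun _ => hb
    let l := Limits.Fork.IsLimit.lift' r.isLimit p hp
    refine ⟨Quasivariety.toHom l.1 (K.freeMk (Term.var PUnit.unit)), ?_⟩
    exact congrArg
      (fun q : T ⟶ B => Quasivariety.toHom q (K.freeMk (Term.var PUnit.unit))) l.2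

end Basic

/-! ### Maps into ultraproducts -/

section Ultraproducts

/-- The element of an ultraproduct represented by a choice function. -/
def Alg.ultraMk {I : Type u} (U : Ultrafilter I) (B : I → Alg L) (b : ∀ i, B i) :
    Alg.ultraproduct U B :=
  Quotient.mk ((U : Filter I).productSetoid fun i => (B i : Type u)) b

theorem Alg.ultraMk_eq_iff {I : Type u} {U : Ultrafilter I} {B : I → Alg L} {b c : ∀ i, B i} :
    Alg.ultraMk U B b = Alg.ultraMk U B c ↔ ∀ᶠ i in (U : Filter I), b i = c i :=
  Quotient.eq''

theorem Alg.funMap_ultraMk {I : Type u} (U : Ultrafilter I) (B : I → Alg L) {n : ℕ}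
    (f : L.Functions n) (x : Fin n → ∀ i, B i) :
    Structure.funMap f (fun k => Alg.ultraMk U B (x k)) =
      Alg.ultraMk U B fun i => Structure.funMap f fun k => x k i :=
  Ultraproduct.funMap_cast f x

/-- Łoś's theorem. -/
theorem Alg.realize_ultraMk {I : Type u} (U : Ultrafilter I) (B : I → Alg L) {α : Type}
    (φ : L.Formula α) (x : α → ∀ i, B i) :
    φ.Realize (fun k => Alg.ultraMk U B (x k)) ↔
      ∀ᶠ i in (U : Filter I), φ.Realize fun k => x k i :=
  Ultraproduct.realize_formula_cast φ x

end Ultraproducts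

/-! ### Primitive positive formulas -/

section PP

theorem isPP_realize_iff {α : Type} {m k : ℕ} (t s : Fin k → L.Term (α ⊕ Fin m))
    {A : Type u} [L.Structure A] (v : α → A) :
    (Formula.iExs (Fin m) (Formula.iInf fun i => (t i).equal (s i))).Realize v ↔
      ∃ w : Fin m → A, ∀ i, (t i).realize (Sum.elim v w) = (s i).realize (Sum.elim v w) := by
  simp [Formula.realize_iExs, Formula.realize_iInf, Formula.realize_equal]

/-- Homomorphisms preserve pp formulas. -/
theorem IsPP.realize_hom {α : Type} {φ : L.Formula α} (hφ : IsPP φ) {A B : Alg L} (h : A →[L] B)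
    {v : α → A} (hv : φ.Realize v) : φ.Realize (h ∘ v) := by
  obtain ⟨m, k, t, s, rfl⟩ := hφ
  obtain ⟨w, hw⟩ := (isPP_realize_iff t s v).1 hv
  refine (isPP_realize_iff t s _).2 ⟨h ∘ w, fun i => ?_⟩
  rw [← Sum.comp_elim, HomClass.realize_term, HomClass.realize_term, hw]

/-- A finite system of equations with finitely many existentially quantified variables is
expressed by a pp formula, whatever finite types index the equations and the variables. -/
theorem exists_isPP {α : Type} {β γ : Type u} [Finite β] [Finite γ] (t s : γ → L.Term (α ⊕ β)) :
    ∃ φ : L.Formula α, IsPP φ ∧ ∀ (A : Alg L) (v : α → A), φ.Realize v ↔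
      ∃ w : β → A, ∀ j, (t j).realize (Sum.elim v w) = (s j).realize (Sum.elim v w) := by
  obtain ⟨m, ⟨eβ⟩⟩ := Finite.exists_equiv_fin β
  obtain ⟨k, ⟨eγ⟩⟩ := Finite.exists_equiv_fin γ
  let r : L.Term (α ⊕ β) → L.Term (α ⊕ Fin m) := Term.relabel (Sum.map id eβ)
  refine ⟨_, ⟨m, k, fun i => r (t (eγ.symm i)), fun i => r (s (eγ.symm i)), rfl⟩,
    fun A v => ?_⟩
  rw [isPP_realize_iff]
  have hr (w : Fin m → A) (p : L.Term (α ⊕ β)) :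
      (r p).realize (Sum.elim v w) = p.realize (Sum.elim v (w ∘ eβ)) := by
    simp only [r, Term.realize_relabel, Sum.elim_comp_map, Function.comp_id]
  simp only [hr]
  constructor
  · rintro ⟨w, hw⟩
    exact ⟨w ∘ eβ, fun j => by simpa using hw (eγ j)⟩
  · rintro ⟨w, hw⟩
    refine ⟨w ∘ eβ.symm, fun i => ?_⟩
    have : (w ∘ eβ.symm) ∘ eβ = w := by ext; simp
    rw [this]
    exact hw _

/-- The operation defined by a pp formula that is functional throughout a quasivariety. -/
def Operation.ofPP {K : Quasivariety L} {n : ℕ} (φ : L.Formula (Fin (n + 1))) (hφ : IsPP φ)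
    (hf : ∀ (A : K.Obj) (a : Fin n → A.alg) (b c : A.alg),
      φ.Realize (Fin.snoc a b : Fin (n + 1) → A.alg) →
        φ.Realize (Fin.snoc a c : Fin (n + 1) → A.alg) → b = c) : Operation K n where
  fn A a := ⟨∃ b, φ.Realize (Fin.snoc a b : Fin (n + 1) → A.alg), fun h => h.choose⟩
  preserved {A B} h a b := by
    rintro ⟨hb, rfl⟩
    have h1 := hφ.realize_hom (Quasivariety.toHom h) hb.choose_spec
    rw [Fin.comp_snoc] at h1
    have h2 : ∃ c, φ.Realize (Fin.snoc (Quasivariety.toHom h ∘ a) c : Fin (n + 1) → B.alg) :=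
      ⟨_, h1⟩
    exact ⟨h2, hf B _ _ _ h2.choose_spec h1⟩

theorem Operation.ofPP_definedBy {K : Quasivariety L} {n : ℕ} (φ : L.Formula (Fin (n + 1)))
    (hφ : IsPP φ) (hf) : (Operation.ofPP (K := K) φ hφ hf).DefinedBy φ := by
  intro A a b
  constructor
  · intro h
    have h2 : ∃ c, φ.Realize (Fin.snoc a c : Fin (n + 1) → A.alg) := ⟨b, h⟩
    exact ⟨h2, hf A a _ _ h2.choose_spec h⟩
  · rintro ⟨hb, rfl⟩
    exact hb.choose_spec

end PP

/-! ### Extensions in which given operations are total -/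

section TotalExtensions

theorem Operation.dom_map {K : Quasivariety L} {n : ℕ} (f : Operation K n) {A B : K.Obj}
    (h : A ⟶ B) {a : Fin n → A.alg} (ha : (f.fn A a).Dom) :
    (f.fn B (Quasivariety.toHom h ∘ a)).Dom :=
  Part.dom_iff_mem.2 ⟨_, f.preserved h a _ (Part.get_mem ha)⟩

theorem exists_extension_finset {K : Quasivariety L} {I : Type u} {n : I → ℕ}
    (f : ∀ i, Operation K (n i)) (hf : ∀ i, (f i).IsExtendable) (A : K.Obj)
    (a : ∀ i, Fin (n i) → A.alg) (S : Finset I) :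
    ∃ (B : K.Obj) (e : A.alg ↪[L] B.alg), ∀ i ∈ S, ((f i).fn B (e ∘ a i)).Dom := by
  classical
  induction S using Finset.induction with
  | empty => exact ⟨A, Embedding.refl L _, by simp⟩
  | insert i S _ ih =>
    obtain ⟨B, e, h⟩ := ih
    obtain ⟨C, e', h'⟩ := hf i B (e ∘ a i)
    refine ⟨C, e'.comp e, fun j hj => ?_⟩
    rcases Finset.mem_insert.1 hj with rfl | hj
    · exact h'
    · exact (f j).dom_map (B := C) (e'.toHom : B.alg →[L] C.alg) (h j hj)

variable [L.IsAlgebraic]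

/-- Extendable definable operations can be made defined on any family of tuples of an algebra at
once: an ultraproduct of the extensions that take care of finitely many tuples. -/
theorem exists_extension_family {K : Quasivariety L} {I : Type u} {n : I → ℕ}
    (f : ∀ i, Operation K (n i)) (hd : ∀ i, ∃ φ, (f i).DefinedBy φ)
    (hf : ∀ i, (f i).IsExtendable) (A : K.Obj) (a : ∀ i, Fin (n i) → A.alg) :
    ∃ (B : K.Obj) (e : A.alg ↪[L] B.alg), ∀ i, ((f i).fn B (e ∘ a i)).Dom := by
  classical
  choose B e h using exists_extension_finset f hf A a
  let U : Ultrafilter (Finset I) := Ultrafilter.of Filter.atTop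
  have hU : ∀ S : Finset I, ∀ᶠ T in (U : Filter (Finset I)), S ≤ T := fun S =>
    Ultrafilter.of_le Filter.atTop (Filter.eventually_ge_atTop S)
  let P : K.Obj := ⟨Alg.ultraproduct U fun S => (B S).alg,
    K.ultraproduct_mem U _ fun S => (B S).mem⟩
  let g : A.alg →[L] P.alg := Alg.homMk (fun x => Alg.ultraMk U _ fun S => e S x)
    (fun m q x => by
      refine Eq.trans ?_ (Alg.funMap_ultraMk U _ q _).symm
      exact congrArg _ (funext fun S => (e S).map_fun q x))
  have hg : Function.Injective g := by
    intro x y hxy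
    obtain ⟨S, hS⟩ := (Alg.ultraMk_eq_iff.1 hxy).exists
    exact (e S).injective hS
  refine ⟨P, Embedding.ofInjective hg, fun i => ?_⟩
  obtain ⟨φ, hφ⟩ := hd i
  let b : ∀ S, (B S).alg := fun S =>
    if hi : i ∈ S then ((f i).fn (B S) (e S ∘ a i)).get (h S i hi) else Classical.arbitrary _
  refine Part.dom_iff_mem.2 ⟨Alg.ultraMk U _ b, (hφ P _ _).1 ?_⟩
  have hs : (Fin.snoc (g ∘ a i) (Alg.ultraMk U _ b) : Fin (n i + 1) → P.alg) =
      fun k => Alg.ultraMk U (fun S => (B S).alg)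
        (fun S => (Fin.snoc (e S ∘ a i) (b S) : Fin (n i + 1) → (B S).alg) k) := by
    funext k
    refine Fin.lastCases ?_ (fun k => ?_) k
    · simp only [Fin.snoc_last]
    · simp only [Fin.snoc_castSucc]
      rfl
  have key : φ.Realize (Fin.snoc (g ∘ a i) (Alg.ultraMk U _ b) : Fin (n i + 1) → P.alg) := by
    rw [hs]
    refine (Alg.realize_ultraMk U (fun S => (B S).alg) φ
      (fun k S => (Fin.snoc (e S ∘ a i) (b S) : Fin (n i + 1) → (B S).alg) k)).2 ?_
    filter_upwards [hU {i}] with S hS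
    have hi : i ∈ S := hS (Finset.mem_singleton_self i)
    refine (hφ (B S) _ _).2 ?_
    simp only [b, dif_pos hi]
    exact Part.get_mem _
  exact key

/-- Quasivarieties are closed under unions of chains: the union embeds into an ultraproduct of
the chain over a nonprincipal ultrafilter. The last clause says that every tuple of elements of
the union lies in a member of the chain. -/
theorem exists_chain_limit {K : Quasivariety L} (G : ℕ → K.Obj)
    (g : ∀ k, (G k).alg ↪[L] (G (k + 1)).alg) :
    ∃ (B : K.Obj) (j : ∀ k, (G k).alg ↪[L] B.alg),
      (∀ k x, j (k + 1) (g k x) = j k x) ∧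
      ∀ {n : ℕ} (b : Fin n → B.alg), ∃ k y, b = j k ∘ y := by
  let A : ℕ → Type u := fun k => (G k).alg
  let F : ∀ i j : ℕ, i ≤ j → A i ↪[L] A j := DirectedSystem.natLERec g
  have hF : DirectedSystem A fun i j h => F i j h := DirectedSystem.natLERec.directedSystem g
  let U : Ultrafilter (ULift.{u} ℕ) := Ultrafilter.of Filter.atTop
  have hU : ∀ i : ℕ, ∀ᶠ j in (U : Filter (ULift.{u} ℕ)), i ≤ j.down := fun i =>
    Ultrafilter.of_le Filter.atTop (Filter.eventually_ge_atTop (ULift.up i))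
  let P : Alg L := Alg.ultraproduct U fun j => (G j.down).alg
  have hP : K.Mem P := K.ultraproduct_mem U _ fun j => (G j.down).mem
  -- The coordinates below `i` are arbitrary, as almost all coordinates are above `i`.
  let v : ∀ i, A i → ∀ j : ULift.{u} ℕ, (G j.down).alg := fun i x j =>
    if h : i ≤ j.down then F i j.down h x else Classical.arbitrary _
  let e : ∀ i, (G i).alg →[L] P := fun i => Alg.homMk (fun x => Alg.ultraMk U _ (v i x))
    (fun m q x => by
      refine Eq.trans ?_ (Alg.funMap_ultraMk U _ q _).symm
      refine Alg.ultraMk_eq_iff.2 ?_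
      filter_upwards [hU i] with j hj
      simp only [v, dif_pos hj]
      exact (F i j.down hj).map_fun q x)
  have he : ∀ i, Function.Injective (e i) := by
    intro i x y hxy
    obtain ⟨j, hj, hij⟩ := ((Alg.ultraMk_eq_iff.1 hxy).and (hU i)).exists
    simp only [v, dif_pos hij] at hj
    exact (F i j.down hij).injective hj
  let D : Alg L :=
    { carrier := Language.DirectLimit A F
      nonempty := ⟨Language.DirectLimit.of L ℕ A F 0 (Classical.arbitrary (G 0).alg)⟩ }
  let l : D ↪[L] P := Language.DirectLimit.lift L ℕ A F (fun i => Embedding.ofInjective (he i))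
    (fun i j hij x => by
      refine Alg.ultraMk_eq_iff.2 ?_
      filter_upwards [hU j] with k hk
      simp only [v, dif_pos hk, dif_pos (hij.trans hk)]
      exact DirectedSystem.map_map (f := fun i j h => F i j h) hij hk x)
  refine ⟨⟨D, K.mem_of_embedding l hP⟩, fun k => Language.DirectLimit.of L ℕ A F k,
    fun k x => ?_, fun b => ?_⟩
  · have h1 : F k (k + 1) k.le_succ x = g k x := by
      simp only [F, DirectedSystem.coe_natLERec]
      exact Nat.leRecOn_succ' (C := A) (next := fun {k} => g k) x
    exact (congrArg (Language.DirectLimit.of L ℕ A F (k + 1)) h1.symm).trans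
      Language.DirectLimit.of_f
  · obtain ⟨i, y, hy⟩ := Language.DirectLimit.exists_quotient_mk'_sigma_mk'_eq A F b
    exact ⟨i, y, hy⟩

/-- Every algebra extends to one on which all members of a given family of extendable definable
operations are total: the union of a chain in which each algebra makes the operations defined on
the tuples of the preceding one. -/
theorem exists_total_extension {K : Quasivariety L} {J : Type u} {n : J → ℕ}
    (f : ∀ j, Operation K (n j)) (hd : ∀ j, ∃ φ, (f j).DefinedBy φ)
    (hf : ∀ j, (f j).IsExtendable) (A : K.Obj) :
    ∃ (B : K.Obj) (_ : A.alg ↪[L] B.alg), ∀ j (b : Fin (n j) → B.alg), ((f j).fn B b).Dom := by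
  choose next emb h using fun A : K.Obj =>
    exists_extension_family (I := Σ j, Fin (n j) → A.alg) (fun i => f i.1) (fun i => hd i.1)
      (fun i => hf i.1) A (fun i => i.2)
  let G : ℕ → K.Obj := fun k => Nat.rec A (fun _ X => next X) k
  obtain ⟨B, e, he, hB⟩ := exists_chain_limit G fun k => emb (G k)
  refine ⟨B, e 0, fun j b => ?_⟩
  obtain ⟨k, y, rfl⟩ := hB b
  have h1 := (f j).dom_map (B := B) ((e (k + 1)).toHom : (G (k + 1)).alg →[L] B.alg)
    (h (G k) ⟨j, y⟩)
  have h2 : e k ∘ y = e (k + 1) ∘ (emb (G k) ∘ y) := funext fun i => (he k (y i)).symm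
  rw [h2]
  exact h1

end TotalExtensions

/-! ### Reflective expansions -/

/-- The element-level content of the second and the third condition: homomorphisms between reducts
of members of `M` preserve all operations of `M`, and every member of `K` embeds into the reduct of
a member of `M`. -/
structure IsReflectiveExpansion (ι : L →ᴸ L₁) (K : Quasivariety L) (M : Quasivariety L₁) :
    Prop where
  map_funMap : ∀ B C : Alg L₁, M.Mem B → M.Mem C → ∀ (h : B.reduct ι →[L] C.reduct ι) (n : ℕ)
    (g : L₁.Functions n) (x : Fin n → B),
    h (Structure.funMap (M := B) g x) = Structure.funMap (M := C) g fun i => h (x i)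
  exists_embedding : ∀ A : Alg L, K.Mem A →
    ∃ B : Alg L₁, M.Mem B ∧ ∃ e : A →[L] B.reduct ι, Function.Injective e

section Simple

variable [L.IsAlgebraic]

/-- The adjoined operations are global, and by extendability all of them can be made total. -/
theorem IsSimplePPExpansion.isReflectiveExpansion [L₁.IsAlgebraic] {ι : L →ᴸ L₁} {K : Quasivariety L}
    {M : Quasivariety L₁} (hι : ι.Injective) (h : IsSimplePPExpansion ι K M) :
    IsReflectiveExpansion ι K M := by
  classical
  obtain ⟨-, F, hF, hM⟩ := h
  constructor
  · intro B C hB hC h n g x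
    obtain ⟨hB', hB⟩ := (hM B).1 hB
    obtain ⟨hC', hC⟩ := (hM C).1 hC
    by_cases hg : g ∈ Set.range (fun f : L.Functions n => ι.onFunction f)
    · obtain ⟨f, rfl⟩ := hg
      exact h.map_fun f x
    · exact Part.mem_unique
        ((F n g hg).preserved (A := ⟨B.reduct ι, hB'⟩) (B := ⟨C.reduct ι, hC'⟩) h x _ (hB n g hg x))
        (hC n g hg _)
  · intro A hA
    let J : Type u := Σ n, {g : L₁.Functions n //
      g ∉ Set.range (fun f : L.Functions n => ι.onFunction f)}
    obtain ⟨B, e, hB⟩ := exists_total_extension (J := J) (fun j => F j.1 j.2.1 j.2.2)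
      (fun j => (hF _ _ _).1.2) (fun j => (hF _ _ _).2.2) ⟨A, hA⟩
    let C : Alg L₁ :=
      { carrier := B.alg
        str :=
          { funMap := fun {n} g x =>
              if hg : g ∈ Set.range (fun f : L.Functions n => ι.onFunction f) then
                Structure.funMap hg.choose x
              else ((F n g hg).fn B x).get (hB ⟨n, g, hg⟩ x)
            RelMap := fun r => isEmptyElim r } }
    have hold : ∀ (n : ℕ) (f : L.Functions n) (x : Fin n → B.alg),
        (Structure.funMap (ι.onFunction f) x : C) = (Structure.funMap f x : B.alg) := by
      intro n f x
      have hg : ι.onFunction f ∈ Set.range (fun f : L.Functions n => ι.onFunction f) := ⟨f, rfl⟩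
      refine (dif_pos hg).trans ?_
      exact congrArg (fun q => (Structure.funMap q x : B.alg)) (hι.onFunction hg.choose_spec)
    let toC : B.alg →[L] C.reduct ι := Alg.homMk id fun n f x => (hold n f x).symm
    let ofC : C.reduct ι →[L] B.alg := Alg.homMk id hold
    have hC : K.Mem (C.reduct ι) := K.mem_of_injective ofC Function.injective_id B.mem
    refine ⟨C, (hM C).2 ⟨hC, fun n g hg x => ?_⟩, toC.comp e.toHom, e.injective⟩
    have h1 : (Structure.funMap g x : C) = ((F n g hg).fn B x).get (hB ⟨n, g, hg⟩ x) :=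
      dif_neg hg
    rw [h1]
    exact (F n g hg).preserved (B := ⟨C.reduct ι, hC⟩) toC x _ (Part.get_mem _)

/-- Compactness: the value of a basic operation of `M` at given elements of `T` is determined by
finitely many equations `f(w) = f^T(w)` of the `L`-diagram of `T`. Otherwise an ultraproduct of
counterexamples would receive a homomorphism from the reduct of `T` that does not preserve the
operation. -/
theorem exists_finset_diagram {ι : L →ᴸ L₁} {K : Quasivariety L} {M : Quasivariety L₁}
    (hM : IsReflectiveExpansion ι K M) {T : Alg L₁} (hT : M.Mem T) {n : ℕ}
    (g : L₁.Functions n) (x : Fin n → T) :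
    ∃ D : Finset (Σ m, L.Functions m × (Fin m → T)), ∀ B : Alg L₁, M.Mem B → ∀ v : T → B,
      (∀ p ∈ D, v (Structure.funMap (ι.onFunction p.2.1) p.2.2) =
        Structure.funMap (ι.onFunction p.2.1) (v ∘ p.2.2)) →
      v (Structure.funMap g x) = Structure.funMap g (v ∘ x) := by
  classical
  by_contra! H
  choose B hB v hv hne using H
  let U : Ultrafilter (Finset (Σ m, L.Functions m × (Fin m → T))) := Ultrafilter.of Filter.atTop
  let P : Alg L₁ := Alg.ultraproduct U B
  let h : T.reduct ι →[L] P.reduct ι :=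
    Alg.homMk (fun z => Alg.ultraMk U B fun D => v D z) (fun m f w => by
      refine Eq.trans ?_ (Alg.funMap_ultraMk U B (ι.onFunction f) _).symm
      refine Alg.ultraMk_eq_iff.2 ?_
      have hU := Ultrafilter.of_le Filter.atTop (Filter.eventually_ge_atTop
        ({⟨m, f, w⟩} : Finset (Σ m, L.Functions m × (Fin m → T))))
      filter_upwards [hU] with D hD
      exact hv D _ (hD (Finset.mem_singleton_self _)))
  have h1 := hM.map_funMap T P hT (M.ultraproduct_mem U B hB) h n g x
  obtain ⟨D, hD⟩ := (Alg.ultraMk_eq_iff.1 (h1.trans (Alg.funMap_ultraMk U B g _))).exists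
  exact hne D hD

variable [L₁.IsAlgebraic]

/-- If homomorphisms of reducts preserve the basic operations of `M`, then each basic operation of
positive arity is defined by a pp formula in the language of `K`. -/
theorem exists_pp_definition {ι : L →ᴸ L₁} {K : Quasivariety L} {M : Quasivariety L₁}
    (hM : IsReflectiveExpansion ι K M) {n : ℕ} (hn : n ≠ 0) (g : L₁.Functions n) :
    ∃ φ : L.Formula (Fin (n + 1)), IsPP φ ∧ ∀ B : Alg L₁, M.Mem B → ∀ (x : Fin n → B) (y : B),
      φ.Realize (M := B.reduct ι) (Fin.snoc x y : Fin (n + 1) → B) ↔ y = Structure.funMap g x := by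
  classical
  have hne : Nonempty (ULift.{u} (Fin n)) := ⟨⟨⟨0, Nat.pos_of_ne_zero hn⟩⟩⟩
  let T : Alg L₁ := M.free (ULift.{u} (Fin n))
  have hT : M.Mem T := M.free_mem _
  let gen : Fin n → T := fun i => M.freeMk (Term.var ⟨i⟩)
  obtain ⟨D, hD⟩ := exists_finset_diagram hM hT g gen
  -- One quantified variable for each argument and for the value of each equation of the diagram;
  -- variables that stand for the same element of `T` are identified by additional equations.
  let β : Type u := Σ p : D, Option (Fin p.1.1)
  let val : Fin (n + 1) ⊕ β → T := Sum.elim (Fin.snoc gen (Structure.funMap g gen))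
    (fun q => q.2.elim (Structure.funMap (ι.onFunction q.1.1.2.1) q.1.1.2.2) q.1.1.2.2)
  let γ : Type u := D ⊕ {q : (Fin (n + 1) ⊕ β) × (Fin (n + 1) ⊕ β) // val q.1 = val q.2}
  let t : γ → L.Term (Fin (n + 1) ⊕ β) := Sum.elim
    (fun p => Term.func p.1.2.1 fun i => Term.var (Sum.inr ⟨p, some i⟩)) (fun q => Term.var q.1.1)
  let s : γ → L.Term (Fin (n + 1) ⊕ β) := Sum.elim
    (fun p => Term.var (Sum.inr ⟨p, none⟩)) (fun q => Term.var q.1.2)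
  obtain ⟨φ, hφ, hφr⟩ := exists_isPP t s
  refine ⟨φ, hφ, fun B hB x y => (hφr (B.reduct ι) _).trans ⟨?_, ?_⟩⟩
  · rintro ⟨w, hw⟩
    let u : Fin (n + 1) ⊕ β → B := Sum.elim (Fin.snoc x y) w
    let v : T → B := fun z => if h : ∃ q, val q = z then u h.choose else Classical.arbitrary B
    have hv : ∀ q, v (val q) = u q := by
      intro q
      have h : ∃ q', val q' = val q := ⟨q, rfl⟩
      exact (dif_pos h).trans (hw (Sum.inr ⟨(h.choose, q), h.choose_spec⟩))
    have h1 := hD B hB v (by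
      intro p hp
      refine (hv (Sum.inr ⟨⟨p, hp⟩, none⟩)).trans ((hw (Sum.inl ⟨p, hp⟩)).symm.trans ?_)
      exact congrArg (Structure.funMap (M := B) (ι.onFunction p.2.1))
        (funext fun i => (hv (Sum.inr ⟨⟨p, hp⟩, some i⟩)).symm))
    have h2 := hv (Sum.inl (Fin.last n))
    have h3 : v ∘ gen = x := by
      funext i
      have h4 := hv (Sum.inl i.castSucc)
      change v ((Fin.snoc gen (Structure.funMap g gen) : Fin (n + 1) → T) i.castSucc) =
        (Fin.snoc x y : Fin (n + 1) → B) i.castSucc at h4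
      rwa [Fin.snoc_castSucc, Fin.snoc_castSucc] at h4
    rw [h3] at h1
    change v ((Fin.snoc gen (Structure.funMap g gen) : Fin (n + 1) → T) (Fin.last n)) =
      (Fin.snoc x y : Fin (n + 1) → B) (Fin.last n) at h2
    rw [Fin.snoc_last, Fin.snoc_last] at h2
    exact h2.symm.trans h1
  · rintro rfl
    let h : T →[L₁] B := M.freeLift hB fun i => x i.down
    have hgen : h ∘ gen = x := rfl
    refine ⟨fun q => h (val (Sum.inr q)), ?_⟩
    have he : (Sum.elim (Fin.snoc x (Structure.funMap g x) : Fin (n + 1) → B)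
        fun q => h (val (Sum.inr q))) = h ∘ val := by
      funext q
      rcases q with q | q
      · refine Fin.lastCases ?_ (fun i => ?_) q
        · simp only [val, Sum.elim_inl, Function.comp_apply, Fin.snoc_last]
          rw [h.map_fun, hgen]
        · simp only [val, Sum.elim_inl, Function.comp_apply, Fin.snoc_castSucc]
          exact (congrFun hgen i).symm
      · rfl
    intro j
    refine (congrArg (fun w => Term.realize (M := B.reduct ι) w (t j)) he).trans
      (Eq.trans ?_ (congrArg (fun w => Term.realize (M := B.reduct ι) w (s j)) he).symm)
    rcases j with p | q
    · exact (h.map_fun (ι.onFunction p.1.2.1) p.1.2.2).symm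
    · exact congrArg h q.2

/-- A pp definition of a basic operation of `M` defines an operation in `ext_pp(K)`: functionality
and extendability are inherited from the reducts of members of `M`, into which the members of `K`
embed. -/
theorem exists_memExtPP {ι : L →ᴸ L₁} {K : Quasivariety L} {M : Quasivariety L₁}
    (hE : IsExpansion ι K M) (hM : IsReflectiveExpansion ι K M) {n : ℕ} (hn : n ≠ 0)
    (g : L₁.Functions n) :
    ∃ f : Operation K n, f.MemExtPP ∧ ∀ (B : Alg L₁) (hB : M.Mem B) (x : Fin n → B) (y : B),
      y ∈ f.fn ⟨B.reduct ι, hE.reduct_mem B hB⟩ x ↔ y = Structure.funMap g x := by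
  obtain ⟨φ, hφ, hφM⟩ := exists_pp_definition hM hn g
  have hf : ∀ (A : K.Obj) (a : Fin n → A.alg) (b c : A.alg),
      φ.Realize (Fin.snoc a b : Fin (n + 1) → A.alg) →
        φ.Realize (Fin.snoc a c : Fin (n + 1) → A.alg) → b = c := by
    intro A a b c hb hc
    obtain ⟨B, hB, e, he⟩ := hM.exists_embedding A.alg A.mem
    have key : ∀ b, φ.Realize (Fin.snoc a b : Fin (n + 1) → A.alg) →
        e b = Structure.funMap (M := B) g (e ∘ a) := by
      intro b hb
      have := hφ.realize_hom e hb
      rw [Fin.comp_snoc] at this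
      exact (hφM B hB _ _).1 this
    exact he ((key b hb).trans (key c hc).symm)
  have hdef := Operation.ofPP_definedBy (K := K) φ hφ hf
  have hval : ∀ (B : Alg L₁) (hB : M.Mem B) (x : Fin n → B) (y : B),
      y ∈ (Operation.ofPP φ hφ hf).fn ⟨B.reduct ι, hE.reduct_mem B hB⟩ x ↔
        y = Structure.funMap g x :=
    fun B hB x y => (hdef _ _ _).symm.trans (hφM B hB x y)
  refine ⟨Operation.ofPP φ hφ hf, ⟨⟨Nat.pos_of_ne_zero hn, φ, hdef⟩, ⟨φ, hφ, hdef⟩, ?_⟩, hval⟩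
  intro A a
  obtain ⟨B, hB, e, he⟩ := hM.exists_embedding A.alg A.mem
  exact ⟨⟨B.reduct ι, hE.reduct_mem B hB⟩, Embedding.ofInjective he,
    Part.dom_iff_mem.2 ⟨_, (hval B hB _ _).2 rfl⟩⟩

theorem IsReflectiveExpansion.isSimplePPExpansion {ι : L →ᴸ L₁} {K : Quasivariety L}
    {M : Quasivariety L₁} (hE : IsExpansion ι K M) (hc : NoNewConstants ι)
    (hM : IsReflectiveExpansion ι K M) : IsSimplePPExpansion ι K M := by
  have hn : ∀ (n : ℕ) (g : L₁.Functions n),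
      g ∉ Set.range (fun f : L.Functions n => ι.onFunction f) → n ≠ 0 := by
    rintro n g hg rfl
    exact hg (hc g)
  choose F hF hFM using fun n g hg => exists_memExtPP hE hM (hn n g hg) g
  have hmem : ∀ A : Alg L₁, M.Mem A ↔ OpFamily.Adjoined (ι := ι) (K := K) F A := by
    refine fun A => ⟨fun hA => ⟨hE.reduct_mem A hA, fun n g hg a => (hFM n g hg A hA _ _).2 rfl⟩, ?_⟩
    rintro ⟨hA, hAF⟩
    -- The embedding of the reduct of `A` into the reduct of a member of `M` preserves the adjoined
    -- operations, so `A` itself embeds into that member.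
    obtain ⟨B, hB, e, he⟩ := hM.exists_embedding _ hA
    refine M.mem_of_injective (Alg.homMk (A := A) (B := B) e fun n g x => ?_) he hB
    by_cases hg : g ∈ Set.range (fun f : L.Functions n => ι.onFunction f)
    · obtain ⟨f, rfl⟩ := hg
      exact e.map_fun f x
    · exact (hFM n g hg B hB _ _).1 ((F n g hg).preserved (A := ⟨A.reduct ι, hA⟩)
        (B := ⟨B.reduct ι, hE.reduct_mem B hB⟩) e x _ (hAF n g hg x))
  refine ⟨⟨F, hF, fun A => ⟨fun hA => ⟨A, (hmem A).1 hA, ⟨Embedding.refl _ _⟩⟩, ?_⟩⟩, F, hF, hmem⟩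
  rintro ⟨B, hB, ⟨e⟩⟩
  exact M.mem_of_embedding e ((hmem B).2 hB)

end Simple

/-! ### The categorical conditions -/

section Categories

universe v₁ v₂ w₁ w₂

variable {C : Type w₁} [Category.{v₁} C] {D : Type w₂} [Category.{v₂} D]

theorem IsCatIso.full {F : C ⥤ D} (hF : IsCatIso F) : F.Full := by
  obtain ⟨G, h₁, h₂⟩ := hF
  exact (CategoryTheory.Equivalence.mk F G (eqToIso h₁.symm) (eqToIso h₂)).full_functor

theorem lift_imageObj_full (F : C ⥤ D) [F.Full] :
    ((imageObj F).lift F fun X => ⟨X, rfl⟩).Full where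
  map_surjective f := ⟨F.preimage f.hom, ObjectProperty.hom_ext _ (F.map_preimage f.hom)⟩

theorem lift_imageObj_faithful (F : C ⥤ D) [F.Faithful] :
    ((imageObj F).lift F fun X => ⟨X, rfl⟩).Faithful where
  map_injective h := F.map_injective (congrArg (fun q => q.hom) h)

theorem isCatIso_of_bijective (F : C ⥤ D) [F.Full] [F.Faithful]
    (hF : Function.Bijective F.obj) : IsCatIso F := by
  let e : C ≃ D := Equiv.ofBijective F.obj hF
  have he : ∀ Y, F.obj (e.symm Y) = Y := e.apply_symm_apply
  have he' : ∀ X, e.symm (F.obj X) = X := e.symm_apply_apply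
  let G : D ⥤ C :=
    { obj := e.symm
      map := fun {Y Z} f => F.preimage (eqToHom (he Y) ≫ f ≫ eqToHom (he Z).symm)
      map_id := fun Y => F.map_injective (by simp)
      map_comp := fun f g => F.map_injective (by simp) }
  refine ⟨G, CategoryTheory.Functor.ext he' fun X Y f => F.map_injective ?_,
    CategoryTheory.Functor.ext he fun X Y f => ?_⟩
  · simp [G, eqToHom_map]
  · simp [G]

/-- A fully faithful functor that is injective on objects and has a left adjoint whose unit is
componentwise a monomorphism is an isomorphism onto a mono-reflective full subcategory. -/
theorem isIsoOntoMonoReflective_of_adjunction {F : D ⥤ C} {U : C ⥤ D} (adj : F ⊣ U) [U.Full]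
    [U.Faithful] (hU : Function.Injective U.obj) (hm : ∀ X, Mono (adj.unit.app X)) :
    IsIsoOntoMonoReflective U where
  image_full := by
    rintro _ _ ⟨X, rfl⟩ ⟨Y, rfl⟩ f
    rw [← U.map_preimage f]
    exact ⟨trivial⟩
  iso := by
    have := lift_imageObj_full U
    have := lift_imageObj_faithful U
    refine isCatIso_of_bijective _ ⟨fun X Y h => hU (congrArg (fun Z => Z.obj) h), ?_⟩
    rintro ⟨_, X, rfl⟩
    exact ⟨X, rfl⟩
  monoReflective := by
    let J := (imageObj U).lift U fun X => ⟨X, rfl⟩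
    have hJ : J.Full := lift_imageObj_full U
    have hbij : ∀ (X : D) (Y : (imageObj U).FullSubcategory), Function.Bijective
        fun f : J.obj (F.obj X) ⟶ Y => (adj.unit.app X ≫ f.hom : X ⟶ Y.obj) := by
      rintro X ⟨_, Y, rfl⟩
      refine ⟨fun f g hfg => ?_, fun f => ?_⟩
      · obtain ⟨f, rfl⟩ := J.map_surjective (Y := Y) f
        obtain ⟨g, rfl⟩ := J.map_surjective (Y := Y) g
        have : f = g := (adj.homEquiv X Y).injective (by
          simp only [Adjunction.homEquiv_unit]
          exact hfg)
        rw [this]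
      · refine ⟨J.map (Y := Y) ((adj.homEquiv X Y).symm f), ?_⟩
        have := (adj.homEquiv X Y).apply_symm_apply f
        rwa [Adjunction.homEquiv_unit] at this
    let a := Adjunction.adjunctionOfEquivLeft (G := (imageObj U).ι)
      (F_obj := fun X => J.obj (F.obj X))
      (fun X Y => Equiv.ofBijective _ (hbij X Y)) (fun X Y Z g h => by simp)
    refine ⟨_, a, fun X => ?_⟩
    have : a.unit.app X = adj.unit.app X := by
      simp [a, Adjunction.adjunctionOfEquivLeft]
      exact Category.comp_id _
    rw [this]
    exact hm X

end Categories

section Conditions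

variable {ι : L →ᴸ L₁} {K : Quasivariety L} {M : Quasivariety L₁}

theorem forgetful_faithful (h : IsExpansion ι K M) : (forgetful h).Faithful where
  map_injective {B C} _ _ e := Hom.ext fun x => congrArg
    (fun r : (forgetful h).obj B ⟶ (forgetful h).obj C => Quasivariety.toHom r x) e

theorem IsReflectiveExpansion.forgetful_full [L₁.IsAlgebraic] (h : IsExpansion ι K M)
    (hM : IsReflectiveExpansion ι K M) : (forgetful h).Full where
  map_surjective {B C} f :=
    ⟨Alg.homMk (A := B.alg) (B := C.alg) (Quasivariety.toHom f)
      (hM.map_funMap _ _ B.mem C.mem (Quasivariety.toHom f)), Hom.ext fun _ => rfl⟩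

/-- A full forgetful functor and embeddings into reducts give back the element-level conditions. -/
theorem isReflectiveExpansion_of_full [L.IsAlgebraic] (h : IsExpansion ι K M)
    (hf : (forgetful h).Full)
    (hm : ∀ A : K.Obj, ∃ (B : M.Obj) (e : A ⟶ (forgetful h).obj B), Mono e) :
    IsReflectiveExpansion ι K M where
  map_funMap B C hB hC p n g x := by
    obtain ⟨q, hq⟩ := hf.map_surjective (X := ⟨B, hB⟩) (Y := ⟨C, hC⟩) p
    have hq' : ∀ b : B, Quasivariety.toHom q b = p b :=
      fun b => congrArg (fun r : (forgetful h).obj ⟨B, hB⟩ ⟶ (forgetful h).obj ⟨C, hC⟩ =>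
        Quasivariety.toHom r b) hq
    have := (Quasivariety.toHom q).map_fun g x
    rw [hq'] at this
    exact this.trans (congrArg _ (funext fun i => hq' (x i)))
  exists_embedding A hA := by
    obtain ⟨B, e, he⟩ := hm ⟨A, hA⟩
    exact ⟨B.alg, B.mem, Quasivariety.toHom e, (mono_iff_injective e).1 he⟩

variable [L.IsAlgebraic] [L₁.IsAlgebraic]

theorem IsReflectiveExpansion.mono_unit (h : IsExpansion ι K M)
    (hM : IsReflectiveExpansion ι K M) (A : K.Obj) : Mono ((freeExtAdj h).unit.app A) := by
  obtain ⟨B, hB, e, he⟩ := hM.exists_embedding A.alg A.mem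
  refine (mono_iff_injective _).2 fun a b hab => he ?_
  exact congrArg (freeExtLift (⟨B, hB⟩ : M.Obj) e) hab

theorem unitMonoCounitIso_iff (h : IsExpansion ι K M) :
    UnitMonoCounitIso h ↔ IsReflectiveExpansion ι K M := by
  constructor
  · rintro ⟨hm, hi⟩
    exact isReflectiveExpansion_of_full h (freeExtAdj h).fullyFaithfulROfIsIsoCounit.full
      fun A => ⟨_, (freeExtAdj h).unit.app A, hm A⟩
  · intro hM
    have := forgetful_faithful h
    have := hM.forgetful_full h
    exact ⟨hM.mono_unit h, inferInstance⟩

/-- The structure of a member of `M` is determined by its reduct: the identity map is a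
homomorphism. -/
theorem IsReflectiveExpansion.forgetful_injective (h : IsExpansion ι K M)
    (hM : IsReflectiveExpansion ι K M) : Function.Injective (forgetful h).obj := by
  rintro ⟨B, hB⟩ ⟨C, hC⟩ e
  have e' : B.reduct ι = C.reduct ι := congrArg Quasivariety.Obj.alg e
  have key := hM.map_funMap B C hB hC
  clear e
  obtain @⟨B, sB, nB⟩ := B
  obtain @⟨C, sC, nC⟩ := C
  simp only [Alg.reduct, Alg.mk.injEq] at e'
  obtain ⟨rfl, e'⟩ := e'
  have e' := eq_of_heq e'
  have : sB = sC := by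
    refine Structure.ext ?_ ?_
    · funext n g x
      exact key (Alg.homMk (A := Alg.reduct ι (@Alg.mk _ B sB nB))
        (B := Alg.reduct ι (@Alg.mk _ B sC nC)) id
        (fun n f x => congrArg (fun s : L.Structure B => s.funMap f x) e')) n g x
    · funext n r
      exact isEmptyElim r
  subst this
  rfl

theorem isIsoOntoMonoReflective_iff (h : IsExpansion ι K M) :
    IsIsoOntoMonoReflective (forgetful h) ↔ IsReflectiveExpansion ι K M := by
  constructor
  · rintro ⟨-, hiso, R, adj, hm⟩
    have hfull := hiso.full
    refine isReflectiveExpansion_of_full h ⟨fun {B C} f => ?_⟩ fun A => ?_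
    · obtain ⟨g, hg⟩ := hfull.map_surjective (X := B) (Y := C) ⟨f⟩
      exact ⟨g, congrArg (fun q => q.hom) hg⟩
    · obtain ⟨B, hB⟩ := (R.obj A).property
      have := hm A
      refine ⟨B, adj.unit.app A ≫ eqToHom hB.symm, ?_⟩
      exact mono_comp _ _
  · intro hM
    have := forgetful_faithful h
    have := hM.forgetful_full h
    exact isIsoOntoMonoReflective_of_adjunction (freeExtAdj h) (hM.forgetful_injective h)
      (hM.mono_unit h)

end Conditions

/-! ### Uniqueness up to term equivalence -/

section TermEquivalence

variable [L₁.IsAlgebraic] [L₂.IsAlgebraic] {ι : L →ᴸ L₁} {ι₂ : L →ᴸ L₂}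
  {K : Quasivariety L} {M : Quasivariety L₁} {N : Quasivariety L₂}

/-- The `L₁`-structure `s` on the universe of an `L₂`-algebra `B` makes it a member of `M` with the
same `L`-reduct as `B`. -/
def IsCompanionStructure (ι : L →ᴸ L₁) (ι₂ : L →ᴸ L₂) (M : Quasivariety L₁) (B : Alg L₂)
    (s : L₁.Structure B) : Prop :=
  M.Mem ⟨B⟩ ∧ ∀ (n : ℕ) (f : L.Functions n) (x : Fin n → B),
    s.funMap (ι.onFunction f) x = Structure.funMap (ι₂.onFunction f) x

/-- Embed the reduct of `B` into that of some `C` in `M`, and the latter into that of some `D` in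
`N`. Operations of `M` are preserved by the homomorphisms of `N`, so their values at elements of `B`
lie in every equalizer in `N` that contains `B`, and by regularity `B` is such an equalizer in
`D`. Hence `B` is a subalgebra of `C`. -/
theorem exists_companionStructure (hN : IsExpansion ι₂ K N) (hM' : IsReflectiveExpansion ι K M)
    (hM : IsExpansion ι K M) (hN' : IsReflectiveExpansion ι₂ K N) [IsRegularMonoCategory N.Obj]
    (B : Alg L₂) (hB : N.Mem B) : ∃ s : L₁.Structure B, IsCompanionStructure ι ι₂ M B s := by
  obtain ⟨C, hC, e, he⟩ := hM'.exists_embedding _ (hN.reduct_mem B hB)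
  obtain ⟨D, hD, d, hd⟩ := hN'.exists_embedding _ (hM.reduct_mem C hC)
  let m : (⟨B, hB⟩ : N.Obj) ⟶ ⟨D, hD⟩ :=
    Alg.homMk (A := B) (B := D) (d.comp e) (hN'.map_funMap B D hB hD (d.comp e))
  obtain ⟨E, p, q, hpq, hrange⟩ := exists_separating m (hd.comp he)
  obtain ⟨G, hG, i, hi⟩ := hM'.exists_embedding _ (hN.reduct_mem E.alg E.mem)
  have closed : ∀ (n : ℕ) (g : L₁.Functions n) (x : Fin n → B),
      ∃ b : B, e b = Structure.funMap (M := C) g fun k => e (x k) := by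
    intro n g x
    let c : C := Structure.funMap (M := C) g fun k => e (x k)
    let p' : C.reduct ι →[L] G.reduct ι :=
      i.comp ((Alg.reductHom ι₂ (Quasivariety.toHom p)).comp d)
    let q' : C.reduct ι →[L] G.reduct ι :=
      i.comp ((Alg.reductHom ι₂ (Quasivariety.toHom q)).comp d)
    have h1 : p' c = q' c := by
      refine (hM'.map_funMap C G hC hG p' n g _).trans
        (Eq.trans ?_ (hM'.map_funMap C G hC hG q' n g _).symm)
      exact congrArg (Structure.funMap (M := G) g) (funext fun k => congrArg i (hpq (x k)))
    obtain ⟨b, hb⟩ := hrange (d c) (hi h1)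
    exact ⟨b, hd hb⟩
  choose op hop using closed
  let s : L₁.Structure B := { funMap := fun {n} g x => op n g x, RelMap := fun r => isEmptyElim r }
  refine ⟨s, M.mem_of_injective (A := ⟨B⟩) (B := C) (Alg.homMk (A := @Alg.mk _ B s _) (B := C) e
    hop) he hC, fun n f x => he ?_⟩
  exact (hop n (ι.onFunction f) x).trans (e.map_fun f x).symm

variable [L.IsAlgebraic]

/-- Homomorphisms of `N` preserve the companion structures, so an operation of `M` is given
throughout `N` by a term representing its value at the generators of a free algebra of `N`. -/
theorem exists_term (hN : IsExpansion ι₂ K N) (hM' : IsReflectiveExpansion ι K M)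
    (hM : IsExpansion ι K M) (hN' : IsReflectiveExpansion ι₂ K N) [IsRegularMonoCategory N.Obj]
    {n : ℕ} (hn : n ≠ 0) (g : L₁.Functions n) :
    ∃ t : L₂.Term (Fin n), ∀ B : Alg L₂, N.Mem B → ∀ s : L₁.Structure B,
      IsCompanionStructure ι ι₂ M B s → ∀ x, s.funMap g x = t.realize x := by
  have hne : Nonempty (ULift.{u} (Fin n)) := ⟨⟨⟨0, Nat.pos_of_ne_zero hn⟩⟩⟩
  let T : Alg L₂ := N.free (ULift.{u} (Fin n))
  have hT : N.Mem T := N.free_mem _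
  obtain ⟨sT, hsT, hsT'⟩ := exists_companionStructure hN hM' hM hN' T hT
  let gen : Fin n → T := fun i => N.freeMk (Term.var ⟨i⟩)
  obtain ⟨t, ht⟩ := N.freeMk_surjective (sT.funMap g gen)
  refine ⟨t.relabel ULift.down, fun B hB s ⟨hs, hs'⟩ x => ?_⟩
  let h : T →[L₂] B := N.freeLift hB fun i => x i.down
  let h' : (@Alg.mk L₁ T sT _).reduct ι →[L] (@Alg.mk L₁ B s _).reduct ι :=
    Alg.homMk (A := (@Alg.mk L₁ T sT _).reduct ι) (B := (@Alg.mk L₁ B s _).reduct ι) h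
      (fun m f y => (congrArg h (hsT' m f y)).trans
        ((h.map_fun _ y).trans (hs' m f (h ∘ y)).symm))
  have h1 := hM'.map_funMap _ _ hsT hs h' n g gen
  have h2 : h (sT.funMap g gen) = t.realize fun i => x i.down := by
    rw [← ht]
    rfl
  rw [Term.realize_relabel]
  exact h1.symm.trans h2

/-- An interpretation of `M` in `N` that is the identity on the language of `K`: every companion
structure of a member `B` of `N` is `τ(B)`. -/
theorem exists_translation (hN : IsExpansion ι₂ K N) (hM' : IsReflectiveExpansion ι K M)
    (hM : IsExpansion ι K M) (hN' : IsReflectiveExpansion ι₂ K N) [IsRegularMonoCategory N.Obj]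
    (hc : NoNewConstants ι) :
    ∃ τ : Translation L₁ L₂, τ.Fixes ι ι₂ ∧ ∀ B : Alg L₂, N.Mem B → ∀ s : L₁.Structure B,
      IsCompanionStructure ι ι₂ M B s → τ.app B = @Alg.mk L₁ B s _ := by
  classical
  have hn : ∀ (n : ℕ) (g : L₁.Functions n),
      g ∉ Set.range (fun f : L.Functions n => ι.onFunction f) → n ≠ 0 := by
    rintro n g hg rfl
    exact hg (hc g)
  choose t ht using fun n g hg => exists_term hN hM' hM hN' (hn n g hg) g
  let τ : Translation L₁ L₂ := fun n g =>
    if hg : g ∈ Set.range (fun f : L.Functions n => ι.onFunction f) then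
      Term.func (ι₂.onFunction hg.choose) fun i => Term.var i
    else t n g hg
  have hτ : τ.Fixes ι ι₂ := by
    intro n f
    have hg : ι.onFunction f ∈ Set.range (fun f : L.Functions n => ι.onFunction f) := ⟨f, rfl⟩
    refine (dif_pos hg).trans ?_
    rw [hM.injective.onFunction hg.choose_spec]
  refine ⟨τ, hτ, fun B hB s hs => ?_⟩
  have : (τ.app B).str = s := by
    refine Structure.ext ?_ ?_
    · funext n g x
      change Term.realize (M := B) x (τ n g) = s.funMap g x
      by_cases hg : g ∈ Set.range (fun f : L.Functions n => ι.onFunction f)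
      · obtain ⟨f, rfl⟩ := hg
        rw [hτ]
        exact (hs.2 n f x).symm
      · rw [ht n g hg B hB s hs x]
        simp only [τ, dif_neg hg]
    · funext n r
      exact isEmptyElim r
  rw [← this]
  rfl

theorem faithfullyTermEquivalent (hM : IsExpansion ι K M) (hM' : IsReflectiveExpansion ι K M)
    (hN : IsExpansion ι₂ K N) (hN' : IsReflectiveExpansion ι₂ K N)
    [IsRegularMonoCategory M.Obj] [IsRegularMonoCategory N.Obj]
    (hc : NoNewConstants ι) (hc₂ : NoNewConstants ι₂) : FaithfullyTermEquivalent ι ι₂ M N := by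
  obtain ⟨τ, hτ, hτN⟩ := exists_translation hN hM' hM hN' hc
  obtain ⟨ρ, hρ, hρM⟩ := exists_translation hM hN' hN hM' hc₂
  refine ⟨τ, ρ, hτ, hρ, fun A hA => ?_, fun B hB => ?_⟩
  · obtain ⟨s, hs⟩ := exists_companionStructure hM hN' hN hM' A hA
    rw [hρM A hA s hs]
    exact ⟨hs.1, hτN ⟨A⟩ hs.1 A.str ⟨hA, fun n f x => (hs.2 n f x).symm⟩⟩
  · obtain ⟨s, hs⟩ := exists_companionStructure hN hM' hM hN' B hB
    rw [hτN B hB s hs]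
    exact ⟨hs.1, hρM ⟨B⟩ hs.1 B.str ⟨hB, fun n f x => (hs.2 n f x).symm⟩⟩

end TermEquivalence

end QV

end

theorem mainTheorem2
    {L L₁ : FirstOrder.Language.{u, 0}} [L.IsAlgebraic] [L₁.IsAlgebraic]
    (ι : L →ᴸ L₁) (K : QV.Quasivariety L) (M : QV.Quasivariety L₁)
    (hM : QV.IsExpansion ι K M) (hc : QV.NoNewConstants ι) :
    (QV.IsSimpleBethCompanion ι K M ↔
      CategoryTheory.IsRegularMonoCategory M.Obj ∧ QV.IsSimplePPExpansion ι K M) ∧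
    (QV.IsSimpleBethCompanion ι K M ↔
      CategoryTheory.IsRegularMonoCategory M.Obj ∧ QV.UnitMonoCounitIso hM) ∧
    (QV.IsSimpleBethCompanion ι K M ↔
      CategoryTheory.IsRegularMonoCategory M.Obj ∧
        QV.IsIsoOntoMonoReflective (QV.forgetful hM)) ∧
    (QV.IsSimpleBethCompanion ι K M →
      ∀ (L₂ : FirstOrder.Language.{u, 0}) [L₂.IsAlgebraic] (ι₂ : L →ᴸ L₂)
        (N : QV.Quasivariety L₂) (hN : QV.IsExpansion ι₂ K N),
        QV.NoNewConstants ι₂ →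
        CategoryTheory.IsRegularMonoCategory N.Obj →
        QV.IsIsoOntoMonoReflective (QV.forgetful hN) →
        QV.FaithfullyTermEquivalent ι ι₂ M N) := by
  have hsimple : QV.IsSimplePPExpansion ι K M ↔ QV.IsReflectiveExpansion ι K M :=
    ⟨fun h => h.isReflectiveExpansion hM.injective, fun h => h.isSimplePPExpansion hM hc⟩
  have hbeth : QV.IsSimpleBethCompanion ι K M ↔
      CategoryTheory.IsRegularMonoCategory M.Obj ∧ QV.IsSimplePPExpansion ι K M :=
    ⟨fun h => ⟨h.1.2, h.2⟩, fun h => ⟨⟨h.2.1, h.1⟩, h.2⟩⟩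
  refine ⟨hbeth, ?_, ?_, ?_⟩
  · rw [hbeth, hsimple, QV.unitMonoCounitIso_iff]
  · rw [hbeth, hsimple, QV.isIsoOntoMonoReflective_iff]
  · intro h L₂ _ ι₂ N hN hc₂ hreg hrefl
    have := h.1.2
    exact QV.faithfullyTermEquivalent hM (hsimple.1 h.2) hN
      ((QV.isIsoOntoMonoReflective_iff hN).1 hrefl) hc hc₂
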